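/- Let $R$ be an associative ring with unit, let $\mathrm{Mod}\text{-}R$ be the category of right $R$-modules, and let $\mathcal{L}(R)=(+,-,0,r)_{r\in R}$ be the first-order language of right $R$-modules. Let $(\mathcal{T},\mathcal{F})$ be a torsion pair in $\mathrm{Mod}\text{-}R$, that is, $\mathcal{T}=\{M : \operatorname{Hom}_R(M,F)=0 \text{ for all } F\in\mathcal{F}\}$ and $\mathcal{F}=\{M : \operatorname{Hom}_R(T,M)=0\text{ for all } T\in\mathcal{T}\}$. Let $t$ be its torsion radical, so that $t(M)$ is the sum of all submodules of $M$ that belong to $\mathcal{T}$. A class of modules is *definable* if it is closed under direct products, pure submodules and direct limits. An additive functor $\mathrm{Mod}\text{-}R\to\mathrm{Ab}$ is *coherent* if it commutes with direct limits and direct products. A *positive primitive* formula is one of the form $\exists y_1\cdots\exists y_k\,\theta$ with $\theta$ a finite conjunction of atomic formulas. For a sentence $\sigma$ of $\mathcal{L}(R)$, $\mathrm{Mod}(\sigma)$ denotes the class of right $R$-modules satisfying $\sigma$; a class of this form is *finitely axiomatizable*. The following are equivalent: 1. $(\mathcal{T},\mathcal{F})$ is elementary, that is, both $\mathcal{T}$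 and $\mathcal{F}$ are definable; 2. $t$, regarded as a functor $\mathrm{Mod}\text{-}R\to\mathrm{Ab}$, is coherent; 3. there is a positive primitive formula $\tau(u)$ in $\mathcal{L}(R)$ such that $t(M)=\tau(M)=\{m\in M : M\models\tau(m)\}$ for every right $R$-module $M$, and $\mathcal{T}=\mathrm{Mod}(\forall u\,\tau(u))$ and $\mathcal{F}=\mathrm{Mod}(\forall u\,(\tau(u)\to u=0))$; in particular $\mathcal{T}$ and $\mathcal{F}$ are finitely axiomatizable. Moreover, whenever a positive primitive formula $\tau(u)$ satisfies $t(M)=\tau(M)$ for every right $R$-module $M$, one has $\mathcal{T}=\mathrm{Mod}(\forall u\,\tau(u))$ and $\mathcal{F}=\mathrm{Mod}(\forall u\,(\tau(u)\to u=0))$. -/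

import Mathlib

open CategoryTheory CategoryTheory.Limits MulOpposite
open scoped FirstOrder

universe u

namespace TorsionPairs

section Language

/-- The function symbols of the language `(+, -, 0, r)_{r ∈ R}` of right `R`-modules: a binary
symbol `+`, a unary symbol `-`, a constant `0`, and for every `r : R` a unary symbol for the
scalar multiplication by `r` on the right. -/
inductive ModuleFunc (R : Type u) : ℕ → Type u
  | zero : ModuleFunc R 0
  | neg : ModuleFunc R 1
  | add : ModuleFunc R 2
  | smul (r : R) : ModuleFunc R 1

/-- The first-order language of right `R`-modules. It has no relation symbol besides equality. -/
def Lang (R : Type u) : FirstOrder.Language.{u, 0} where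
  Functions := ModuleFunc R
  Relations := fun _ => Empty

/-- Every right `R`-module, that is, every module over `Rᵐᵒᵖ`, is a structure for the language
of right `R`-modules in the evident way. -/
instance moduleStructure (R : Type u) [Ring R] (M : Type u) [AddCommGroup M] [Module Rᵐᵒᵖ M] :
    (Lang R).Structure M where
  funMap {n} f := match n, f with
    | _, ModuleFunc.zero => fun _ => 0
    | _, ModuleFunc.neg => fun x => -(x 0)
    | _, ModuleFunc.add => fun x => x 0 + x 1
    | _, ModuleFunc.smul r => fun x => op r • x 0
  RelMap {_} r _ := Empty.elim r

/-- The constant `0` as a term. -/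
def zeroTerm (R : Type u) (α : Type) : (Lang R).Term α :=
  FirstOrder.Language.Term.func (l := 0) (ModuleFunc.zero : ModuleFunc R 0) Fin.elim0

/-- Finite (nonempty) conjunctions of atomic formulas. -/
inductive IsAtomicConj {L : FirstOrder.Language.{u, 0}} {α : Type} {n : ℕ} : L.BoundedFormula α n → Prop
  | of_isAtomic {φ : L.BoundedFormula α n} (h : φ.IsAtomic) : IsAtomicConj φ
  | inf {φ ψ : L.BoundedFormula α n} (hφ : IsAtomicConj φ) (hψ : IsAtomicConj ψ) :
      IsAtomicConj (φ ⊓ ψ)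

/-- Positive primitive formulas: `∃ y₁ … y_k, θ` with `θ` a finite conjunction of atomic
formulas. -/
inductive IsPosPrimitive {L : FirstOrder.Language.{u, 0}} {α : Type} :
    {n : ℕ} → L.BoundedFormula α n → Prop
  | of_isAtomicConj {n : ℕ} {φ : L.BoundedFormula α n} (h : IsAtomicConj φ) : IsPosPrimitive φ
  | ex {n : ℕ} {φ : L.BoundedFormula α (n + 1)} (h : IsPosPrimitive φ) : IsPosPrimitive φ.ex

/-- Formulas `τ(u)` of the language of right `R`-modules with at most one free variable `u`,
the de Bruijn variable `&0`. -/
abbrev UnaryFormula (R : Type u) := (Lang R).BoundedFormula Empty 1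

/-- The sentence `∀ u, τ(u)`. -/
def allSentence {R : Type u} (τ : UnaryFormula R) : (Lang R).Sentence :=
  FirstOrder.Language.BoundedFormula.all τ

/-- The sentence `∀ u, (τ(u) → u = 0)`. -/
def onlyZeroSentence {R : Type u} (τ : UnaryFormula R) : (Lang R).Sentence :=
  FirstOrder.Language.BoundedFormula.all
    (τ.imp (FirstOrder.Language.Term.bdEqual (FirstOrder.Language.Term.var (Sum.inr (0 : Fin 1))) (zeroTerm R _)))

end Language

variable (R : Type u) [Ring R]

/-- The category of right `R`-modules. -/
abbrev RightMod := ModuleCat.{u} Rᵐᵒᵖ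

variable {R}

/-- `Mod(σ)`: the class of all right `R`-modules in which the sentence `σ` holds. -/
def ModelClass (σ : (Lang R).Sentence) : ObjectProperty (RightMod R) :=
  fun M => M ⊨ σ

/-- A class of right `R`-modules is finitely axiomatizable, relative to the theory of right
`R`-modules, if it is the class of all right `R`-modules satisfying some sentence. -/
def IsFinitelyAxiomatizable (C : ObjectProperty (RightMod R)) : Prop :=
  ∃ σ : (Lang R).Sentence, C = ModelClass σ

/-- Pure monomorphisms: every finite system of linear equations
`∑ j, x j * r i j = a i` with constants `a i` from `N` that is solvable in `M` is solvable
in `N`. -/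
def IsPureMono {N M : RightMod R} (f : N ⟶ M) : Prop :=
  Function.Injective f ∧
    ∀ (m n : ℕ) (r : Fin m → Fin n → R) (a : Fin m → N),
      (∃ y : Fin n → M, ∀ i, ∑ j, op (r i j) • y j = f (a i)) →
        ∃ x : Fin n → N, ∀ i, ∑ j, op (r i j) • x j = a i

/-- A class of right `R`-modules is definable if it is closed under direct products, pure
submodules and direct limits (of systems indexed by nonempty directed preorders). -/
structure IsDefinable (C : ObjectProperty (RightMod R)) : Prop where
  products : ∀ J : Type u, C.IsClosedUnderLimitsOfShape (Discrete J)
  pureSubmodules : ∀ ⦃N M : RightMod R⦄ (f : N ⟶ M), IsPureMono f → C M → C N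
  directLimits : ∀ (I : Type u) [Preorder I] [IsDirectedOrder I] [Nonempty I],
    C.IsClosedUnderColimitsOfShape I

/-- An additive functor from right `R`-modules to abelian groups is coherent if it commutes with
direct limits and direct products. -/
structure IsCoherent (F : RightMod R ⥤ AddCommGrpCat.{u}) : Prop where
  additive : F.Additive
  products : ∀ J : Type u, PreservesLimitsOfShape (Discrete J) F
  directLimits : ∀ (I : Type u) [Preorder I] [IsDirectedOrder I] [Nonempty I],
    PreservesColimitsOfShape I F

/-- A torsion pair: `T` consists of the modules with no nonzero homomorphism to a module in `F`,
and `F` consists of the modules with no nonzero homomorphism from a module in `T`. -/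
structure IsTorsionPair (T F : ObjectProperty (RightMod R)) : Prop where
  torsion_eq : T = F.leftOrthogonal
  torsionFree_eq : F = T.rightOrthogonal

/-- A torsion pair `(T, F)` is elementary if both `T` and `F` are definable. -/
def IsElementary (T F : ObjectProperty (RightMod R)) : Prop :=
  IsDefinable T ∧ IsDefinable F

/-- The torsion submodule `t(M)`: the sum of all submodules of `M` that belong to `T`. -/
def torsionSubmodule (T : ObjectProperty (RightMod R)) (M : RightMod R) : Submodule Rᵐᵒᵖ M :=
  sSup {N : Submodule Rᵐᵒᵖ M | T (ModuleCat.of Rᵐᵒᵖ N)}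

/-- Homomorphic images of torsion modules are torsion. -/
theorem IsTorsionPair.of_surjective {T F : ObjectProperty (RightMod R)} (h : IsTorsionPair T F)
    {M N : RightMod R} (f : M ⟶ N) (hf : Function.Surjective f) (hM : T M) : T N := by
  rw [h.torsion_eq] at hM ⊢
  intro Y g hY
  have : Epi f := (ModuleCat.epi_iff_surjective f).2 hf
  rw [← cancel_epi f, comp_zero]
  exact hM _ hY

theorem IsTorsionPair.map_torsionSubmodule_le {T F : ObjectProperty (RightMod R)}
    (h : IsTorsionPair T F) {M N : RightMod R} (f : M ⟶ N) :
    torsionSubmodule T M ≤ (torsionSubmodule T N).comap f.hom := by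
  refine sSup_le fun K hK => ?_
  rw [← Submodule.map_le_iff_le_comap]
  refine le_sSup ?_
  have hs : Function.Surjective (f.hom.submoduleMap K) := f.hom.submoduleMap_surjective K
  exact h.of_surjective (ModuleCat.ofHom (f.hom.submoduleMap K)) hs hK

/-- The torsion radical of a torsion pair `(T, F)`, as a subfunctor of the identity: it sends `M`
to `t(M)` and a homomorphism to its restriction. -/
def torsionRadical {T F : ObjectProperty (RightMod R)} (h : IsTorsionPair T F) :
    RightMod R ⥤ RightMod R where
  obj M := ModuleCat.of Rᵐᵒᵖ (torsionSubmodule T M)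
  map f := ModuleCat.ofHom (f.hom.restrict (h.map_torsionSubmodule_le f))

/-- The torsion radical as a functor to abelian groups. -/
def torsionRadicalAb {T F : ObjectProperty (RightMod R)} (h : IsTorsionPair T F) :
    RightMod R ⥤ AddCommGrpCat.{u} :=
  torsionRadical h ⋙ forget₂ (RightMod R) AddCommGrpCat.{u}

/-- The formula `τ(u)` defines the torsion radical: `t(M) = τ(M)` for every module `M`. -/
def DefinesRadical (τ : UnaryFormula R) (T : ObjectProperty (RightMod R)) : Prop :=
  ∀ (M : RightMod R) (m : M), m ∈ torsionSubmodule T M ↔ τ.Realize default ![m]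

end TorsionPairs

/-! Everything passes through two properties of the radical: `TorsionCommutesWithProducts` and
`TorsionCommutesWithDirectLimits`. Definability of the pair gives both: products of torsion modules
are torsion, and a direct limit of the torsion-free quotients `D i / t(D i)` is torsion-free.
Coherence gives both at once.

The two properties force a positive primitive definition of `t`. Write `M` as a free module modulo
relations, hence as a direct limit of quotients by finitely many relations. A torsion element of `M`
lifts to a torsion element of one such quotient, and "some homomorphism from that quotient sends the
lift to `y`" is a positive primitive condition on `y` that implies torsion
(`exists_ppSet_of_mem_torsionSubmodule`). If no single condition defined `t`, choosing for each
condition contained in `t` a torsion element violating it would give a torsion element of a product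
satisfying none of them, a contradiction (`exists_ppSet_eq_torsionSubmodule`).

Conversely, positive primitive conditions commute with products and direct limits and are reflected
by pure embeddings, which yields definability. -/

namespace TorsionPairs

open FirstOrder.Language

/-! ### Positive primitive formulas as solvability of linear systems -/

section PositivePrimitive

variable {R : Type u} [Ring R]

/-- The subset of a right module `M` defined by the positive primitive condition
`∃ y, ∀ i, ∑ l, y l * s i l = x * r i`. -/
def ppSet {m k : ℕ} (r : Fin m → R) (s : Fin m → Fin k → R) (M : RightMod R) : Set M :=
  {x | ∃ y : Fin k → M, ∀ i, ∑ l, op (s i l) • y l = op (r i) • x}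

theorem map_mem_ppSet {m k : ℕ} {r : Fin m → R} {s : Fin m → Fin k → R} {M N : RightMod R}
    (f : M ⟶ N) {x : M} (hx : x ∈ ppSet r s M) : f x ∈ ppSet r s N := by
  obtain ⟨y, hy⟩ := hx
  refine ⟨fun l => f (y l), fun i => ?_⟩
  have := congrArg f (hy i)
  simpa [map_sum, map_smul] using this

/-- With `x` fixed, the condition is a finite linear system with constants `x * r i` from `N`, which
is what purity addresses. -/
theorem mem_ppSet_of_isPureMono {m k : ℕ} {r : Fin m → R} {s : Fin m → Fin k → R}
    {N M : RightMod R} {f : N ⟶ M} (hf : IsPureMono f) {x : N} (hx : f x ∈ ppSet r s M) :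
    x ∈ ppSet r s N := by
  obtain ⟨y, hy⟩ := hx
  exact hf.2 m k s (fun i => op (r i) • x) ⟨y, fun i => by rw [hy i, ← map_smul]⟩

theorem mem_ppSet_pi {m k : ℕ} {r : Fin m → R} {s : Fin m → Fin k → R} {J : Type u}
    {M : J → RightMod R} {x : ∀ j, M j} (hx : ∀ j, x j ∈ ppSet r s (M j)) :
    x ∈ ppSet r s (ModuleCat.of Rᵐᵒᵖ (∀ j, M j)) := by
  choose y hy using hx
  refine ⟨fun l j => y j l, fun i => ?_⟩
  funext j
  have := hy j i
  rw [Finset.sum_apply]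
  exact this

/-- Every term of the language of modules is a linear combination of its variables. -/
theorem exists_term_realize_eq_sum {n : ℕ} (t : (Lang R).Term (Empty ⊕ Fin n)) :
    ∃ c : Fin n → R, ∀ (M : RightMod R) (x : Fin n → M),
      t.realize (Sum.elim default x) = ∑ j, op (c j) • x j := by
  classical
  induction t with
  | var a =>
    rcases a with e | j
    · exact e.elim
    · refine ⟨Pi.single j 1, fun M x => ?_⟩
      rw [Finset.sum_eq_single j]
      · simp
      · intro i _ hi
        simp [Pi.single_eq_of_ne hi]
      · simp
  | func f ts ih =>
    choose c hc using ih
    cases f with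
    | zero => 
      refine ⟨0, fun M x => ?_⟩
      trans (0 : M)
      · rfl
      · simp
    | neg =>
      refine ⟨-c 0, fun M x => ?_⟩
      trans -((ts 0).realize (Sum.elim default x))
      · rfl
      · simp [hc]
    | add =>
      refine ⟨c 0 + c 1, fun M x => ?_⟩
      trans (ts 0).realize (Sum.elim default x) + (ts 1).realize (Sum.elim default x)
      · rfl
      · simp [hc, add_smul, Finset.sum_add_distrib]
    | smul a =>
      refine ⟨fun j => c 0 j * a, fun M x => ?_⟩
      trans op a • ((ts 0).realize (Sum.elim default x))
      · rfl
      · simp [hc, Finset.smul_sum, mul_smul]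

/-- Every linear combination of variables is realized by a term. -/
theorem exists_term_of_sum {n : ℕ} (c : Fin n → R) :
    ∃ t : (Lang R).Term (Empty ⊕ Fin n), ∀ (M : RightMod R) (x : Fin n → M),
      t.realize (Sum.elim default x) = ∑ j, op (c j) • x j := by
  classical
  suffices H : ∀ S : Finset (Fin n), ∃ t : (Lang R).Term (Empty ⊕ Fin n),
      ∀ (M : RightMod R) (x : Fin n → M),
        t.realize (Sum.elim default x) = ∑ j ∈ S, op (c j) • x j from H Finset.univ
  intro S
  induction S using Finset.induction_on with
  | empty => exact ⟨zeroTerm R _, fun M x => rfl⟩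
  | insert a S ha ih =>
    obtain ⟨t, ht⟩ := ih
    let t' : (Lang R).Term (Empty ⊕ Fin n) :=
      Term.func (l := 1) (ModuleFunc.smul (c a) : ModuleFunc R 1) ![Term.var (Sum.inr a)]
    refine ⟨Term.func (l := 2) (ModuleFunc.add : ModuleFunc R 2) ![t', t], fun M x => ?_⟩
    rw [Finset.sum_insert ha, ← ht]
    rfl

theorem exists_system_of_isAtomicConj {n : ℕ} {φ : (Lang R).BoundedFormula Empty n}
    (hφ : IsAtomicConj φ) : ∃ (ι : Type) (_ : Finite ι) (r : ι → Fin n → R),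
      ∀ (M : RightMod R) (x : Fin n → M),
        φ.Realize default x ↔ ∀ i, ∑ j, op (r i j) • x j = 0 := by
  induction hφ with
  | of_isAtomic h =>
    cases h with
    | equal t₁ t₂ =>
      obtain ⟨c₁, h₁⟩ := exists_term_realize_eq_sum t₁
      obtain ⟨c₂, h₂⟩ := exists_term_realize_eq_sum t₂
      refine ⟨Unit, inferInstance, fun _ => c₁ - c₂, fun M x => ?_⟩
      simp [BoundedFormula.realize_bdEqual, h₁, h₂, sub_smul, sub_eq_zero]
    | rel S _ => exact Empty.elim S
  | inf _ _ ih₁ ih₂ =>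
    obtain ⟨ι₁, _, r₁, h₁⟩ := ih₁
    obtain ⟨ι₂, _, r₂, h₂⟩ := ih₂
    refine ⟨ι₁ ⊕ ι₂, inferInstance, Sum.elim r₁ r₂, fun M x => ?_⟩
    simp [h₁, h₂]

theorem exists_system_of_isPosPrimitive {n : ℕ} {φ : (Lang R).BoundedFormula Empty n}
    (hφ : IsPosPrimitive φ) : ∃ (ι : Type) (_ : Finite ι) (k : ℕ) (r : ι → Fin n → R)
      (s : ι → Fin k → R), ∀ (M : RightMod R) (x : Fin n → M),
        φ.Realize default x ↔
          ∃ y : Fin k → M, ∀ i, ∑ l, op (s i l) • y l = ∑ j, op (r i j) • x j := by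
  induction hφ with
  | of_isAtomicConj h =>
    obtain ⟨ι, hι, r, hr⟩ := exists_system_of_isAtomicConj h
    refine ⟨ι, hι, 0, r, fun _ => Fin.elim0, fun M x => ?_⟩
    simp [hr, eq_comm]
  | ex _ ih =>
    obtain ⟨ι, hι, k, r, s, h⟩ := ih
    -- The newly quantified variable moves from the right-hand side to the unknowns, hence the sign.
    refine ⟨ι, hι, k + 1, fun i j => r i j.castSucc,
      fun i => Fin.snoc (s i) (-r i (Fin.last _)), fun M x => ?_⟩
    simp only [BoundedFormula.realize_ex, h, Fin.sum_univ_castSucc, Fin.snoc_castSucc,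
      Fin.snoc_last]
    constructor
    · rintro ⟨a, y, hy⟩
      refine ⟨Fin.snoc y a, fun i => ?_⟩
      simp [hy i]
    · rintro ⟨y, hy⟩
      refine ⟨y (Fin.last _), fun l => y l.castSucc, fun i => ?_⟩
      rw [← hy i]
      simp

/-- A unary positive primitive formula defines a set of the form `ppSet r s`. -/
theorem exists_ppSet_of_isPosPrimitive {τ : UnaryFormula R} (hτ : IsPosPrimitive τ) :
    ∃ (m k : ℕ) (r : Fin m → R) (s : Fin m → Fin k → R), ∀ (M : RightMod R) (x : M),
      τ.Realize default ![x] ↔ x ∈ ppSet r s M := by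
  obtain ⟨ι, hι, k, r, s, h⟩ := exists_system_of_isPosPrimitive hτ
  obtain ⟨m, ⟨e⟩⟩ := Finite.exists_equiv_fin ι
  refine ⟨m, k, fun i => r (e.symm i) 0, fun i => s (e.symm i), fun M x => ?_⟩
  rw [h]
  simp only [ppSet, Set.mem_ofPred_eq]
  refine exists_congr fun y => ?_
  rw [← e.symm.forall_congr_right]
  simp

theorem exists_isAtomicConj_of_system {n m : ℕ} (a : Fin m → Fin n → R) :
    ∃ φ : (Lang R).BoundedFormula Empty n, IsAtomicConj φ ∧
      ∀ (M : RightMod R) (x : Fin n → M),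
        φ.Realize default x ↔ ∀ i, ∑ j, op (a i j) • x j = 0 := by
  induction m with
  | zero =>
    refine ⟨(zeroTerm R _).bdEqual (zeroTerm R _), .of_isAtomic (.equal _ _), fun M x => ?_⟩
    simp [BoundedFormula.realize_bdEqual]
  | succ m ih =>
    obtain ⟨φ, hφ, h⟩ := ih fun i => a i.succ
    obtain ⟨t, ht⟩ := exists_term_of_sum (a 0)
    refine ⟨t.bdEqual (zeroTerm R _) ⊓ φ, .inf (.of_isAtomic (.equal _ _)) hφ, fun M x => ?_⟩
    rw [BoundedFormula.realize_inf, h, BoundedFormula.realize_bdEqual, ht, Fin.forall_fin_succ]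
    rfl

theorem exists_isPosPrimitive_ex {n k : ℕ} (φ : (Lang R).BoundedFormula Empty (n + k))
    (hφ : IsPosPrimitive φ) : ∃ ψ : (Lang R).BoundedFormula Empty n, IsPosPrimitive ψ ∧
      ∀ (M : RightMod R) (x : Fin n → M),
        ψ.Realize default x ↔ ∃ y : Fin k → M, φ.Realize default (Fin.append x y) := by
  induction k with
  | zero =>
    refine ⟨φ, hφ, fun M x => ?_⟩
    have (y : Fin 0 → M) : Fin.append x y = x := by
      rw [Subsingleton.elim y Fin.elim0, Fin.append_elim0]
      rfl
    simp [this]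
  | succ k ih =>
    obtain ⟨ψ, hψ, h⟩ := ih φ.ex hφ.ex
    refine ⟨ψ, hψ, fun M x => ?_⟩
    rw [h]
    constructor
    · rintro ⟨y, hy⟩
      obtain ⟨b, hb⟩ := BoundedFormula.realize_ex.1 hy
      exact ⟨Fin.snoc y b, by rwa [Fin.append_snoc]⟩
    · rintro ⟨y, hy⟩
      refine ⟨Fin.init y, BoundedFormula.realize_ex.2 ⟨y (Fin.last k), ?_⟩⟩
      rwa [← Fin.append_snoc, Fin.snoc_init_self]

/-- Sets of the form `ppSet r s` are defined by positive primitive formulas. -/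
theorem exists_isPosPrimitive_of_ppSet {m k : ℕ} (r : Fin m → R) (s : Fin m → Fin k → R) :
    ∃ τ : UnaryFormula R, IsPosPrimitive τ ∧ ∀ (M : RightMod R) (x : M),
      τ.Realize default ![x] ↔ x ∈ ppSet r s M := by
  -- The coefficient `-r i` on the free variable makes the system homogeneous.
  obtain ⟨φ, hφ, h⟩ :=
    exists_isAtomicConj_of_system fun i => Fin.append (fun _ : Fin 1 => -r i) (s i)
  obtain ⟨τ, hτ, h'⟩ := exists_isPosPrimitive_ex φ (.of_isAtomicConj hφ)
  refine ⟨τ, hτ, fun M x => ?_⟩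
  rw [h']
  refine exists_congr fun y => ?_
  rw [h]
  refine forall_congr' fun i => ?_
  rw [Fin.sum_univ_add]
  simp only [Fin.append_left, Fin.append_right, Fin.sum_univ_one, MulOpposite.op_neg, neg_smul,
    neg_add_eq_zero]
  exact eq_comm

end PositivePrimitive

/-! ### The torsion radical and its exactness properties -/

section Torsion

variable {R : Type u} [Ring R] {T F : ObjectProperty (RightMod R)}

theorem IsTorsionPair.torsion_iff_hom_eq_zero (h : IsTorsionPair T F) (M : RightMod R) :
    T M ↔ ∀ ⦃Y : RightMod R⦄ (f : M ⟶ Y), F Y → f = 0 := by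
  conv_lhs => rw [h.torsion_eq]
  rfl

/-- A map to a torsion-free module kills each torsion submodule, so it kills their sum. -/
theorem IsTorsionPair.torsion_torsionSubmodule (h : IsTorsionPair T F) (M : RightMod R) :
    T (ModuleCat.of Rᵐᵒᵖ (torsionSubmodule T M)) := by
  rw [h.torsion_iff_hom_eq_zero]
  intro Y g hY
  have key : torsionSubmodule T M ≤ (LinearMap.ker g.hom).map (torsionSubmodule T M).subtype := by
    refine sSup_le fun N hN => ?_
    have hle : N ≤ torsionSubmodule T M := le_sSup hN
    have hN' := hN
    rw [Set.mem_ofPred_eq, h.torsion_iff_hom_eq_zero] at hN'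
    have h0 := hN' (ModuleCat.ofHom (Submodule.inclusion hle) ≫ g) hY
    intro x hx
    exact ⟨⟨x, hle hx⟩, LinearMap.mem_ker.2 (ConcreteCategory.congr_hom h0 ⟨x, hx⟩), rfl⟩
  ext x
  obtain ⟨z, hz, hzx⟩ := key x.2
  have : z = x := Subtype.ext hzx
  exact this ▸ hz

theorem mem_torsionSubmodule_of_torsion {M : RightMod R} (hM : T M)
    (hT : ∀ ⦃M N : RightMod R⦄ (f : M ⟶ N), Function.Surjective f → T M → T N) (x : M) :
    x ∈ torsionSubmodule T M := by
  have : (⊤ : Submodule Rᵐᵒᵖ M) ∈ {N : Submodule Rᵐᵒᵖ M | T (ModuleCat.of Rᵐᵒᵖ N)} :=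
    hT (ModuleCat.ofHom (Submodule.topEquiv (R := Rᵐᵒᵖ) (M := M)).symm.toLinearMap)
      (Submodule.topEquiv (R := Rᵐᵒᵖ) (M := M)).symm.surjective hM
  exact le_sSup this Submodule.mem_top

theorem IsTorsionPair.torsion_iff (h : IsTorsionPair T F) (M : RightMod R) :
    T M ↔ ∀ x : M, x ∈ torsionSubmodule T M := by
  refine ⟨fun hM => mem_torsionSubmodule_of_torsion hM fun M N f => h.of_surjective f,
    fun hM => ?_⟩
  exact h.of_surjective (ModuleCat.ofHom (torsionSubmodule T M).subtype)
    (fun x => ⟨⟨x, hM x⟩, rfl⟩) (h.torsion_torsionSubmodule M)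

theorem IsTorsionPair.map_mem_torsionSubmodule (h : IsTorsionPair T F) {M N : RightMod R}
    (f : M ⟶ N) {x : M} (hx : x ∈ torsionSubmodule T M) : f x ∈ torsionSubmodule T N :=
  h.map_torsionSubmodule_le f hx

theorem IsTorsionPair.torsionFree_iff (h : IsTorsionPair T F) (M : RightMod R) :
    F M ↔ ∀ x ∈ torsionSubmodule T M, x = 0 := by
  constructor
  · intro hM x hx
    rw [h.torsionFree_eq] at hM
    have := hM (ModuleCat.ofHom (torsionSubmodule T M).subtype) (h.torsion_torsionSubmodule M)
    exact ConcreteCategory.congr_hom this ⟨x, hx⟩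
  · intro hM
    rw [h.torsionFree_eq]
    intro X f hX
    ext x
    exact hM _ (h.map_mem_torsionSubmodule f ((h.torsion_iff X).1 hX x))

/-- The preimage in `M` of the torsion of `M / t(M)` is an extension of torsion by torsion, hence
torsion, hence contained in `t(M)`. -/
theorem IsTorsionPair.torsionFree_quotient (h : IsTorsionPair T F) (M : RightMod R) :
    F (ModuleCat.of Rᵐᵒᵖ (M ⧸ torsionSubmodule T M)) := by
  set t := torsionSubmodule T M with ht
  let Q := ModuleCat.of Rᵐᵒᵖ (M ⧸ t)
  rw [h.torsionFree_iff]
  let K : Submodule Rᵐᵒᵖ M := (torsionSubmodule T Q).comap t.mkQ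
  have htK : t ≤ K := fun x hx => by
    have : t.mkQ x = 0 := (Submodule.Quotient.mk_eq_zero t).2 hx
    change t.mkQ x ∈ torsionSubmodule T Q
    rw [this]
    exact zero_mem _
  have hK : T (ModuleCat.of Rᵐᵒᵖ K) := by
    rw [h.torsion_iff_hom_eq_zero]
    intro Y g hY
    let q : K →ₗ[Rᵐᵒᵖ] torsionSubmodule T Q := t.mkQ.restrict fun _ hx => hx
    have hq : Function.Surjective q := by
      rintro ⟨y, hy⟩
      obtain ⟨x, rfl⟩ := t.mkQ_surjective y
      exact ⟨⟨x, hy⟩, rfl⟩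
    have hker : LinearMap.ker q ≤ LinearMap.ker g.hom := by
      intro x hx
      have hxt : (x : M) ∈ t := (Submodule.Quotient.mk_eq_zero t).1 (congrArg Subtype.val hx)
      have hT := h.torsion_torsionSubmodule M
      rw [h.torsion_iff_hom_eq_zero] at hT
      have := hT (ModuleCat.ofHom (Submodule.inclusion htK) ≫ g) hY
      exact ConcreteCategory.congr_hom this ⟨x, hxt⟩
    -- Since `g` vanishes on `t(M)`, it factors through the torsion module `t(Q)`, and the factor
    -- must be zero.
    let g' : torsionSubmodule T Q →ₗ[Rᵐᵒᵖ] Y :=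
      (LinearMap.ker q).liftQ g.hom hker ∘ₗ
        (q.quotKerEquivOfSurjective hq).symm.toLinearMap
    have hT := h.torsion_torsionSubmodule Q
    rw [h.torsion_iff_hom_eq_zero] at hT
    have h0 := hT (ModuleCat.ofHom g') hY
    ext x
    have hx := ConcreteCategory.congr_hom h0 (q x)
    have he : (q.quotKerEquivOfSurjective hq).symm (q x) = (LinearMap.ker q).mkQ x := by
      rw [LinearEquiv.symm_apply_eq]
      rfl
    have hg : g' (q x) = g x := by
      change (LinearMap.ker q).liftQ g.hom hker ((q.quotKerEquivOfSurjective hq).symm (q x)) = _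
      rw [he]
      rfl
    exact hg.symm.trans hx
  intro x hx
  obtain ⟨y, rfl⟩ := t.mkQ_surjective x
  exact (Submodule.Quotient.mk_eq_zero t).2 ((le_sSup hK : K ≤ torsionSubmodule T M) hx)

variable (T) in
/-- The torsion submodule of a product contains the product of the torsion submodules. -/
def TorsionCommutesWithProducts : Prop :=
  ∀ (J : Type u) (M : J → RightMod R) (x : ∀ j, M j),
    (∀ j, x j ∈ torsionSubmodule T (M j)) →
      (x : ModuleCat.of Rᵐᵒᵖ (∀ j, M j)) ∈ torsionSubmodule T (ModuleCat.of Rᵐᵒᵖ (∀ j, M j))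

variable (T) in
/-- Torsion elements of a direct limit come from torsion elements at some stage. -/
def TorsionCommutesWithDirectLimits : Prop :=
  ∀ (I : Type u) [Preorder I] [IsDirectedOrder I] [Nonempty I] (D : I ⥤ RightMod R)
    (c : Cocone D) (_ : IsColimit c) (x : c.pt), x ∈ torsionSubmodule T c.pt →
      ∃ (i : I) (y : D.obj i), y ∈ torsionSubmodule T (D.obj i) ∧ c.ι.app i y = x

theorem IsTorsionPair.commutesWithProducts_of_isDefinable (h : IsTorsionPair T F)
    (hT : IsDefinable T) : TorsionCommutesWithProducts T := by
  intro J M x hx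
  let t : J → RightMod R := fun j => ModuleCat.of Rᵐᵒᵖ (torsionSubmodule T (M j))
  have := hT.products J
  have hP : T (ModuleCat.of Rᵐᵒᵖ (∀ j, t j)) :=
    T.prop_of_isLimit (ModuleCat.productConeIsLimit t)
      fun j => h.torsion_torsionSubmodule (M j.as)
  let f : ModuleCat.of Rᵐᵒᵖ (∀ j, t j) ⟶ ModuleCat.of Rᵐᵒᵖ (∀ j, M j) :=
    ModuleCat.ofHom (LinearMap.pi fun j => (torsionSubmodule T (M j)).subtype ∘ₗ LinearMap.proj j)
  exact h.map_mem_torsionSubmodule f ((h.torsion_iff _).1 hP fun j => ⟨x j, hx j⟩)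

/-- A torsion element dies in the torsion-free limit of the quotients `D i / t(D i)`, so a
representative already dies at a finite stage, where it is therefore torsion. -/
theorem IsTorsionPair.commutesWithDirectLimits_of_isDefinable (h : IsTorsionPair T F)
    (hF : IsDefinable F) : TorsionCommutesWithDirectLimits T := by
  intro I _ _ _ D c hc x hx
  let D' : I ⥤ RightMod R :=
    { obj i := ModuleCat.of Rᵐᵒᵖ (D.obj i ⧸ torsionSubmodule T (D.obj i))
      map f := ModuleCat.ofHom (Submodule.mapQ _ _ (D.map f).hom (h.map_torsionSubmodule_le _))
      map_id i := by
        ext y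
        simp
      map_comp f g := by
        ext y
        simp }
  let p : D ⟶ D' :=
    { app i := ModuleCat.ofHom (torsionSubmodule T (D.obj i)).mkQ
      naturality i j f := by
        ext y
        rfl }
  have := hF.directLimits I
  have hC : F (colimit D') :=
    F.prop_of_isColimit (colimit.isColimit D') fun i => h.torsionFree_quotient (D.obj i)
  let c' : Cocone D := (Cocone.precompose p).obj (colimit.cocone D')
  have h0 := (h.torsionFree_iff _).1 hC _ (h.map_mem_torsionSubmodule (hc.desc c') hx)
  obtain ⟨i, y, rfl⟩ := Concrete.isColimit_exists_rep D hc x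
  rw [← ConcreteCategory.comp_apply, hc.fac] at h0
  have h1 : colimit.ι D' i (p.app i y) = colimit.ι D' i 0 := by
    rw [map_zero]
    exact h0
  obtain ⟨j, f, g, hfg⟩ := Concrete.colimit_exists_of_rep_eq D' _ _ h1
  refine ⟨j, D.map f y, ?_, ?_⟩
  · rw [map_zero] at hfg
    exact (Submodule.Quotient.mk_eq_zero _).1 hfg
  · rw [← ConcreteCategory.comp_apply, c.w]

theorem IsTorsionPair.commutesWithProducts_of_isCoherent (h : IsTorsionPair T F)
    (hc : IsCoherent (torsionRadicalAb h)) : TorsionCommutesWithProducts T := by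
  intro J M x hx
  have := hc.products J
  have hl := isLimitOfPreserves (torsionRadicalAb h) (ModuleCat.productConeIsLimit M)
  have hl' := isLimitOfPreserves (forget AddCommGrpCat.{u}) hl
  obtain ⟨z, hz, -⟩ := (Types.isLimit_iff _).1 ⟨hl'⟩
    (fun j => (⟨x j.as, hx j.as⟩ : torsionSubmodule T (M j.as))) (by
      rintro ⟨i⟩ ⟨j⟩ ⟨⟨f⟩⟩
      obtain rfl : i = j := f
      rfl)
  have hzx : (z : torsionSubmodule T (ModuleCat.of Rᵐᵒᵖ (∀ j, M j))).1 = x := by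
    funext j
    exact congrArg Subtype.val (hz ⟨j⟩)
  rw [← hzx]
  exact Subtype.property _

theorem IsTorsionPair.commutesWithDirectLimits_of_isCoherent (h : IsTorsionPair T F)
    (hc : IsCoherent (torsionRadicalAb h)) : TorsionCommutesWithDirectLimits T := by
  intro I _ _ _ D c hcol x hx
  have := hc.directLimits I
  have hl := isColimitOfPreserves (torsionRadicalAb h) hcol
  obtain ⟨i, y, hy⟩ := Concrete.isColimit_exists_rep _ hl (⟨x, hx⟩ : torsionSubmodule T c.pt)
  exact ⟨i, (y : torsionSubmodule T (D.obj i)).1, (y : torsionSubmodule T (D.obj i)).2,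
    congrArg Subtype.val hy⟩

end Torsion

/-! ### Quotients as direct limits of quotients by finitely generated submodules -/

section QuotientSystem

variable {S : Type u} [Ring S] {E : Type u} [AddCommGroup E] [Module S E] (K : Submodule S E)

/-- The system of quotients of `E` by the finitely generated submodules of `K`. -/
def fgQuotientSystem : {L : Submodule S E // L.FG ∧ L ≤ K} ⥤ ModuleCat.{u} S where
  obj L := ModuleCat.of S (E ⧸ L.1)
  map f := ModuleCat.ofHom (Submodule.factor (Subtype.coe_le_coe.2 (leOfHom f)))
  map_id L := by
    ext x
    rfl
  map_comp f g := by
    ext x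
    rfl

/-- The cocone over `fgQuotientSystem K` with point the quotient of `E` by `K`. -/
def fgQuotientCocone : Cocone (fgQuotientSystem K) where
  pt := ModuleCat.of S (E ⧸ K)
  ι :=
    { app L := ModuleCat.ofHom (Submodule.factor L.2.2)
      naturality L L' f := by
        ext x
        obtain ⟨x, rfl⟩ := L.1.mkQ_surjective x
        rfl }

/-- The quotient of `E` by `K` is the direct limit of the quotients of `E` by the finitely
generated submodules of `K`. -/
def fgQuotientCoconeIsColimit : IsColimit (fgQuotientCocone K) := by
  -- A cocone is determined by its component at the zero submodule, a map out of `E` itself.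
  let bot : {L : Submodule S E // L.FG ∧ L ≤ K} := ⟨⊥, Submodule.fg_bot, bot_le⟩
  have key (s : Cocone (fgQuotientSystem K)) (L) (x : E) :
      s.ι.app L (L.1.mkQ x) = s.ι.app bot (bot.1.mkQ x) :=
    (ConcreteCategory.congr_hom (s.w (homOfLE (show bot ≤ L from (bot_le : ⊥ ≤ L.1)))) (bot.1.mkQ x))
  have hK (s : Cocone (fgQuotientSystem K)) :
      K ≤ LinearMap.ker ((s.ι.app bot).hom ∘ₗ bot.1.mkQ) := by
    intro x hx
    let L : {L : Submodule S E // L.FG ∧ L ≤ K} :=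
      ⟨Submodule.span S {x}, Submodule.fg_span_singleton x,
        (Submodule.span_singleton_le_iff_mem _ _).2 hx⟩
    have h0 : L.1.mkQ x = 0 :=
      (Submodule.Quotient.mk_eq_zero _).2 (Submodule.mem_span_singleton_self x)
    rw [LinearMap.mem_ker]
    refine (key s L x).symm.trans ?_
    rw [h0]
    exact map_zero _
  exact
    { desc s := ModuleCat.ofHom (K.liftQ ((s.ι.app bot).hom ∘ₗ bot.1.mkQ) (hK s))
      fac s L := by
        ext x
        obtain ⟨x, rfl⟩ := L.1.mkQ_surjective x
        exact (key s L x).symm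
      uniq s m hm := by
        ext x
        obtain ⟨x, rfl⟩ := K.mkQ_surjective x
        exact ConcreteCategory.congr_hom (hm bot) (bot.1.mkQ x) }

instance : IsDirectedOrder {L : Submodule S E // L.FG ∧ L ≤ K} where
  directed L L' := ⟨⟨L.1 ⊔ L'.1, L.2.1.sup L'.2.1, sup_le L.2.2 L'.2.2⟩,
    show L.1 ≤ _ from le_sup_left, show L'.1 ≤ _ from le_sup_right⟩

instance : Nonempty {L : Submodule S E // L.FG ∧ L ≤ K} :=
  ⟨⟨⊥, Submodule.fg_bot, bot_le⟩⟩

end QuotientSystem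

/-! ### From commutation properties to a positive primitive definition -/

section

variable {R : Type u} [Ring R] {T F : ObjectProperty (RightMod R)}

/-- If torsion commutes with direct limits, every torsion element satisfies a positive primitive
condition that only torsion elements satisfy. -/
theorem IsTorsionPair.exists_ppSet_of_mem_torsionSubmodule (h : IsTorsionPair T F)
    (hD : TorsionCommutesWithDirectLimits T) {M : RightMod R} {x : M}
    (hx : x ∈ torsionSubmodule T M) :
    ∃ (m k : ℕ) (r : Fin m → R) (s : Fin m → Fin k → R),
      (∀ (N : RightMod R), ∀ y ∈ ppSet r s N, y ∈ torsionSubmodule T N) ∧ x ∈ ppSet r s M := by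
  classical
  let π : (M →₀ Rᵐᵒᵖ) →ₗ[Rᵐᵒᵖ] M := Finsupp.linearCombination Rᵐᵒᵖ id
  have hπ : Function.Surjective π := fun y => ⟨Finsupp.single y 1, by simp [π]⟩
  let K := LinearMap.ker π
  let e := π.quotKerEquivOfSurjective hπ
  have hx' : e.symm x ∈ torsionSubmodule T (ModuleCat.of Rᵐᵒᵖ ((M →₀ Rᵐᵒᵖ) ⧸ K)) :=
    h.map_mem_torsionSubmodule
      (ModuleCat.ofHom e.symm.toLinearMap : M ⟶ ModuleCat.of Rᵐᵒᵖ ((M →₀ Rᵐᵒᵖ) ⧸ K)) hx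
  obtain ⟨L, a, ha, hax⟩ := hD _ _ _ (fgQuotientCoconeIsColimit K) _ hx'
  obtain ⟨f, rfl⟩ := L.1.mkQ_surjective a
  have hf : π f = x := by
    have h1 : K.mkQ f = e.symm x := hax
    rw [LinearEquiv.eq_symm_apply] at h1
    exact h1
  obtain ⟨p, g, hg⟩ := Submodule.fg_iff_exists_fin_generating_family.1 L.2.1
  have hgK (i : Fin p) : π (g i) = 0 :=
    L.2.2 (hg ▸ Submodule.subset_span ⟨i, rfl⟩)
  -- Only these finitely many basis elements occur in the lift `f` and the relations `g i`.
  let A : Finset M := f.support ∪ Finset.univ.biUnion fun i => (g i).support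
  let v : Fin A.card → M := fun l => A.equivFin.symm l
  have hsum (w : M →₀ Rᵐᵒᵖ) (hw : w.support ⊆ A) : ∑ l, w (v l) • v l = π w := by
    rw [Finsupp.linearCombination_apply, Finsupp.sum_of_support_subset _ hw _ (by simp),
      ← Finset.sum_coe_sort A, ← A.equivFin.symm.sum_comp]
    rfl
  -- Equation `0` says that `y` is the combination `f` of the unknowns; the others, with right-hand
  -- side `0`, say that the unknowns satisfy the relations `g i`.
  refine ⟨p + 1, A.card, Fin.cons 1 0,
    Fin.cons (fun l => unop (f (v l))) fun i l => unop (g i (v l)), fun N y hy => ?_, ?_⟩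
  · obtain ⟨z, hz⟩ := hy
    rw [Fin.forall_fin_succ] at hz
    obtain ⟨hz0, hz⟩ := hz
    simp only [Fin.cons_zero, Fin.cons_succ, op_unop, op_one, one_smul, Pi.zero_apply,
      MulOpposite.op_zero, zero_smul] at hz0 hz
    -- A solution `z` gives values on the basis elements in `A`; the others go to zero.
    let ψ : (M →₀ Rᵐᵒᵖ) →ₗ[Rᵐᵒᵖ] N :=
      ∑ l, (LinearMap.toSpanSingleton Rᵐᵒᵖ N (z l)) ∘ₗ Finsupp.lapply (v l)
    have hψ (w : M →₀ Rᵐᵒᵖ) : ψ w = ∑ l, w (v l) • z l := by simp [ψ]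
    have hL : L.1 ≤ LinearMap.ker ψ := by
      rw [← hg, Submodule.span_le]
      rintro _ ⟨i, rfl⟩
      exact LinearMap.mem_ker.2 ((hψ _).trans (hz i))
    have := h.map_mem_torsionSubmodule
      (ModuleCat.ofHom (L.1.liftQ ψ hL) : ModuleCat.of Rᵐᵒᵖ ((M →₀ Rᵐᵒᵖ) ⧸ L.1) ⟶ N) ha
    rw [← hz0, ← hψ]
    exact this
  · refine ⟨v, Fin.cases ?_ fun i => ?_⟩
    · simpa using (hsum f Finset.subset_union_left).trans hf
    · simpa using (hsum (g i) ((Finset.subset_biUnion_of_mem (fun i => (g i).support)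
        (Finset.mem_univ i)).trans Finset.subset_union_right)).trans (hgK i)

/-- If torsion commutes with products and direct limits, it is defined by a positive primitive
condition. -/
theorem IsTorsionPair.exists_ppSet_eq_torsionSubmodule (h : IsTorsionPair T F)
    (hP : TorsionCommutesWithProducts T) (hD : TorsionCommutesWithDirectLimits T) :
    ∃ (m k : ℕ) (r : Fin m → R) (s : Fin m → Fin k → R),
      ∀ (M : RightMod R) (x : M), x ∈ torsionSubmodule T M ↔ x ∈ ppSet r s M := by
  -- The conditions contained in `t` form a type in `Type u`, so a product can be indexed by them.
  let Φ : Type u := {φ : Σ m k : ℕ, (Fin m → R) × (Fin m → Fin k → R) //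
    ∀ (N : RightMod R), ∀ y ∈ ppSet φ.2.2.1 φ.2.2.2 N, y ∈ torsionSubmodule T N}
  by_contra! hne
  have key (φ : Φ) : ∃ (M : RightMod R) (x : M), x ∈ torsionSubmodule T M ∧
      x ∉ ppSet φ.1.2.2.1 φ.1.2.2.2 M := by
    obtain ⟨M, x, hx⟩ := hne φ.1.1 φ.1.2.1 φ.1.2.2.1 φ.1.2.2.2
    rcases hx with hx | hx
    · exact ⟨M, x, hx⟩
    · exact (hx.1 (φ.2 M x hx.2)).elim
  choose M x hx hx' using key
  obtain ⟨m, k, r, s, hφ, hxφ⟩ := h.exists_ppSet_of_mem_torsionSubmodule hD (hP Φ M x hx)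
  -- Diagonal step: the condition met by the whole family is itself an index, and projecting to that
  -- coordinate contradicts its choice.
  let φ : Φ := ⟨⟨m, k, r, s⟩, hφ⟩
  refine hx' φ ?_
  let pr : ModuleCat.of Rᵐᵒᵖ (∀ j, M j) ⟶ M φ := ModuleCat.ofHom (LinearMap.proj φ)
  exact map_mem_ppSet pr hxφ

/-- Positive primitive conditions commute with direct limits. -/
theorem exists_mem_ppSet_of_isColimit {m k : ℕ} {r : Fin m → R} {s : Fin m → Fin k → R}
    {I : Type u} [Preorder I] [IsDirectedOrder I] [Nonempty I] {D : I ⥤ RightMod R}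
    {c : Cocone D} (hc : IsColimit c) {x : c.pt} (hx : x ∈ ppSet r s c.pt) :
    ∃ (i : I) (y : D.obj i), y ∈ ppSet r s (D.obj i) ∧ c.ι.app i y = x := by
  obtain ⟨z, hz⟩ := hx
  obtain ⟨i₀, x₀, hx₀⟩ := Concrete.isColimit_exists_rep D hc x
  choose j w hw using fun l => Concrete.isColimit_exists_rep D hc (z l)
  obtain ⟨i₁, hi₁⟩ := Finite.exists_le j
  obtain ⟨i, hi₀, hi₁'⟩ := exists_ge_ge i₀ i₁
  have htrans {a b : I} (f : a ⟶ b) (y : D.obj a) : c.ι.app b (D.map f y) = c.ι.app a y := by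
    rw [← ConcreteCategory.comp_apply, c.w]
  let x' : D.obj i := D.map (homOfLE hi₀) x₀
  let w' : Fin k → D.obj i := fun l => D.map (homOfLE ((hi₁ l).trans hi₁')) (w l)
  have hx' : c.ι.app i x' = x := (htrans (homOfLE hi₀) x₀).trans hx₀
  have hw' (l) : c.ι.app i (w' l) = z l := (htrans (homOfLE ((hi₁ l).trans hi₁')) (w l)).trans (hw l)
  -- Each equation holds from some later stage on; being finitely many, they hold at a common one.
  have heq (a : Fin m) : ∃ b : I, ∃ f : i ⟶ b,
      D.map f (∑ l, op (s a l) • w' l) = D.map f (op (r a) • x') := by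
    have h1 : c.ι.app i (∑ l, op (s a l) • w' l) = c.ι.app i (op (r a) • x') := by
      rw [map_sum, map_smul, hx', ← hz a]
      exact Finset.sum_congr rfl fun l _ => by rw [map_smul, hw']
    obtain ⟨b, f, g, hfg⟩ := Concrete.isColimit_exists_of_rep_eq D hc _ _ h1
    obtain rfl : f = g := Subsingleton.elim _ _
    exact ⟨b, f, hfg⟩
  choose b f hf using heq
  obtain ⟨t₀, ht₀⟩ := Finite.exists_le b
  obtain ⟨t, hit, ht₀'⟩ := exists_ge_ge i t₀
  refine ⟨t, D.map (homOfLE hit) x', ⟨fun l => D.map (homOfLE hit) (w' l), fun a => ?_⟩,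
    (htrans (homOfLE hit) x').trans hx'⟩
  have h2 := congrArg (D.map (homOfLE ((ht₀ a).trans ht₀'))) (hf a)
  rw [← ConcreteCategory.comp_apply, ← ConcreteCategory.comp_apply, ← D.map_comp,
    Subsingleton.elim (f a ≫ _) (homOfLE hit)] at h2
  rw [← map_smul, ← h2, map_sum]
  exact Finset.sum_congr rfl fun l _ => by rw [map_smul]

/-! ### Definability, coherence and axioms from the behaviour of the radical -/

section Definable

variable {m k : ℕ} {r : Fin m → R} {s : Fin m → Fin k → R}

theorem commutesWithProducts_of_ppSet
    (hrs : ∀ (M : RightMod R) (x : M), x ∈ torsionSubmodule T M ↔ x ∈ ppSet r s M) :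
    TorsionCommutesWithProducts T := fun _ _ _ hx =>
  (hrs _ _).2 (mem_ppSet_pi fun j => (hrs _ _).1 (hx j))

theorem commutesWithDirectLimits_of_ppSet
    (hrs : ∀ (M : RightMod R) (x : M), x ∈ torsionSubmodule T M ↔ x ∈ ppSet r s M) :
    TorsionCommutesWithDirectLimits T := by
  intro I _ _ _ D c hc x hx
  obtain ⟨i, y, hy, hyx⟩ := exists_mem_ppSet_of_isColimit hc ((hrs _ _).1 hx)
  exact ⟨i, y, (hrs _ _).2 hy, hyx⟩

theorem IsTorsionPair.mem_torsionSubmodule_of_isLimit (h : IsTorsionPair T F)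
    (hP : TorsionCommutesWithProducts T) {J : Type u} {D : Discrete J ⥤ RightMod R} {c : Cone D}
    (hc : IsLimit c) {x : c.pt} (hx : ∀ j, c.π.app j x ∈ torsionSubmodule T (D.obj j)) :
    x ∈ torsionSubmodule T c.pt := by
  let P := ModuleCat.of Rᵐᵒᵖ (∀ j, D.obj ⟨j⟩)
  let c' : Cone D :=
    { pt := P
      π := Discrete.natTrans fun j => ModuleCat.ofHom (LinearMap.proj j.as) }
  let z : P := fun j => c.π.app ⟨j⟩ x
  have hz : z ∈ torsionSubmodule T P := hP J (fun j => D.obj ⟨j⟩) z fun j => hx ⟨j⟩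
  have hzx : hc.lift c' z = x := by
    refine Concrete.isLimit_ext D hc _ _ fun j => ?_
    rw [← ConcreteCategory.comp_apply, hc.fac]
    rfl
  rw [← hzx]
  exact h.map_mem_torsionSubmodule _ hz

/-- Direct limits hold for any torsion class; the positive primitive definition is what handles
products and pure submodules. -/
theorem IsTorsionPair.isDefinable_torsion (h : IsTorsionPair T F)
    (hrs : ∀ (M : RightMod R) (x : M), x ∈ torsionSubmodule T M ↔ x ∈ ppSet r s M) :
    IsDefinable T where
  products J := ⟨fun M ⟨p⟩ => by
    rw [h.torsion_iff]
    intro x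
    exact h.mem_torsionSubmodule_of_isLimit (commutesWithProducts_of_ppSet hrs) p.isLimit
      fun j => (h.torsion_iff _).1 (p.prop_diag_obj j) _⟩
  pureSubmodules N M f hf hM := by
    rw [h.torsion_iff] at hM ⊢
    intro x
    exact (hrs _ _).2 (mem_ppSet_of_isPureMono hf ((hrs _ _).1 (hM (f x))))
  directLimits I _ _ _ := ⟨fun M ⟨p⟩ => by
    rw [h.torsion_iff]
    intro x
    obtain ⟨i, y, rfl⟩ := Concrete.isColimit_exists_rep _ p.isColimit x
    exact h.map_mem_torsionSubmodule _ ((h.torsion_iff _).1 (p.prop_diag_obj i) y)⟩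

/-- Products and submodules hold for any torsion-free class; only direct limits need the lifting of
torsion elements. -/
theorem IsTorsionPair.isDefinable_torsionFree (h : IsTorsionPair T F)
    (hD : TorsionCommutesWithDirectLimits T) : IsDefinable F where
  products J := ⟨fun M ⟨p⟩ => by
    rw [h.torsionFree_iff]
    intro x hx
    refine Concrete.isLimit_ext _ p.isLimit _ _ fun j => ?_
    rw [map_zero]
    exact (h.torsionFree_iff _).1 (p.prop_diag_obj j) _ (h.map_mem_torsionSubmodule _ hx)⟩
  pureSubmodules N M f hf hM := by
    rw [h.torsionFree_iff] at hM ⊢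
    intro x hx
    refine hf.1 ?_
    rw [map_zero]
    exact hM _ (h.map_mem_torsionSubmodule f hx)
  directLimits I _ _ _ := ⟨fun M ⟨p⟩ => by
    rw [h.torsionFree_iff]
    intro x hx
    obtain ⟨i, y, hy, hyx⟩ := hD I _ _ p.isColimit x hx
    rw [(h.torsionFree_iff _).1 (p.prop_diag_obj i) y hy, map_zero] at hyx
    exact hyx.symm⟩

/-- As `t` is a subfunctor of the identity, uniqueness for products and injectivity for direct
limits are inherited; the hypotheses supply existence of elements. -/
theorem IsTorsionPair.isCoherent_torsionRadicalAb (h : IsTorsionPair T F)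
    (hP : TorsionCommutesWithProducts T) (hD : TorsionCommutesWithDirectLimits T) :
    IsCoherent (torsionRadicalAb h) where
  additive := ⟨by
    intro X Y f g
    ext x
    rfl⟩
  products J := ⟨fun {D} => ⟨fun {c} hc => by
    suffices H : Nonempty (IsLimit ((forget AddCommGrpCat.{u}).mapCone
        ((torsionRadicalAb h).mapCone c))) from ⟨isLimitOfReflects _ H.some⟩
    rw [Types.isLimit_iff]
    intro σ hσ
    let σ' (j : Discrete J) : torsionSubmodule T (D.obj j) := σ j
    obtain ⟨x, hx, hu⟩ := (Types.isLimit_iff _).1 ⟨isLimitOfPreserves (forget (RightMod R)) hc⟩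
      (fun j => (σ' j : D.obj j)) fun {i j} f => congrArg Subtype.val (hσ f)
    have hxt : (x : c.pt) ∈ torsionSubmodule T c.pt :=
      h.mem_torsionSubmodule_of_isLimit hP hc fun j => by
        have : c.π.app j x = σ' j := hx j
        rw [this]
        exact (σ' j).2
    refine ⟨(⟨x, hxt⟩ : torsionSubmodule T c.pt), fun j => Subtype.ext (hx j), fun y hy => ?_⟩
    let y' : torsionSubmodule T c.pt := y
    exact Subtype.ext (hu y'.1 fun j => congrArg Subtype.val (hy j))⟩⟩
  directLimits I _ _ _ := ⟨fun {D} => ⟨fun {c} hc => by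
    suffices H : Nonempty (IsColimit ((forget AddCommGrpCat.{u}).mapCocone
        ((torsionRadicalAb h).mapCocone c))) by
      have : ReflectsColimitsOfShape I (forget AddCommGrpCat.{u}) :=
        reflectsColimitsOfShape_of_reflectsIsomorphisms
      exact ⟨isColimitOfReflects _ H.some⟩
    refine ⟨Types.FilteredColimit.isColimitOf' _ _ (fun x => ?_) fun i x y hxy => ?_⟩
    · let x' : torsionSubmodule T c.pt := x
      obtain ⟨i, y, hy, hyx⟩ := hD I D c hc x'.1 x'.2
      exact ⟨i, (⟨y, hy⟩ : torsionSubmodule T (D.obj i)), (Subtype.ext hyx).symm⟩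
    · let x' : torsionSubmodule T (D.obj i) := x
      let y' : torsionSubmodule T (D.obj i) := y
      have h1 : c.ι.app i x'.1 = c.ι.app i y'.1 := congrArg Subtype.val hxy
      obtain ⟨j, f, g, hfg⟩ := Concrete.isColimit_exists_of_rep_eq D hc _ _ h1
      obtain rfl : f = g := Subsingleton.elim _ _
      exact ⟨j, f, Subtype.ext hfg⟩⟩⟩

theorem IsTorsionPair.eq_modelClass_allSentence (h : IsTorsionPair T F) {τ : UnaryFormula R}
    (hτ : DefinesRadical τ T) : T = ModelClass (allSentence τ) := by
  funext M
  rw [h.torsion_iff, eq_iff_iff]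
  refine forall_congr' fun x => ?_
  rw [hτ M x]
  have : (![x] : Fin 1 → M) = Fin.snoc default x := by
    funext i
    rw [Subsingleton.elim i (Fin.last 0), Fin.snoc_last]
    rfl
  rw [this]

theorem IsTorsionPair.eq_modelClass_onlyZeroSentence (h : IsTorsionPair T F)
    {τ : UnaryFormula R} (hτ : DefinesRadical τ T) : F = ModelClass (onlyZeroSentence τ) := by
  funext M
  rw [h.torsionFree_iff, eq_iff_iff]
  refine forall_congr' fun x => ?_
  rw [hτ M x]
  have : (![x] : Fin 1 → M) = Fin.snoc default x := by
    funext i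
    rw [Subsingleton.elim i (Fin.last 0), Fin.snoc_last]
    rfl
  rw [this]
  rfl

end Definable

end

end TorsionPairs

open TorsionPairs in
theorem theorem1p3 {R : Type u} [Ring R] (T F : ObjectProperty (RightMod R))
    (h : IsTorsionPair T F) :
    (IsElementary T F ↔ IsCoherent (torsionRadicalAb h)) ∧
    (IsElementary T F ↔ ∃ τ : UnaryFormula R, IsPosPrimitive τ ∧ DefinesRadical τ T ∧
      T = ModelClass (allSentence τ) ∧ F = ModelClass (onlyZeroSentence τ) ∧
      IsFinitelyAxiomatizable T ∧ IsFinitelyAxiomatizable F) ∧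
    (∀ τ : UnaryFormula R, IsPosPrimitive τ → DefinesRadical τ T →
      T = ModelClass (allSentence τ) ∧ F = ModelClass (onlyZeroSentence τ)) := by
  have elementary_of_ppSet {m k : ℕ} {r : Fin m → R} {s : Fin m → Fin k → R}
      (hrs : ∀ (M : RightMod R) (x : M), x ∈ torsionSubmodule T M ↔ x ∈ ppSet r s M) :
      IsElementary T F :=
    ⟨h.isDefinable_torsion hrs, h.isDefinable_torsionFree (commutesWithDirectLimits_of_ppSet hrs)⟩
  refine ⟨⟨fun he => ?_, fun hc => ?_⟩, ⟨fun he => ?_, ?_⟩, fun τ _ hd =>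
    ⟨h.eq_modelClass_allSentence hd, h.eq_modelClass_onlyZeroSentence hd⟩⟩
  · exact h.isCoherent_torsionRadicalAb (h.commutesWithProducts_of_isDefinable he.1)
      (h.commutesWithDirectLimits_of_isDefinable he.2)
  · obtain ⟨m, k, r, s, hrs⟩ := h.exists_ppSet_eq_torsionSubmodule
      (h.commutesWithProducts_of_isCoherent hc) (h.commutesWithDirectLimits_of_isCoherent hc)
    exact elementary_of_ppSet hrs
  · obtain ⟨m, k, r, s, hrs⟩ := h.exists_ppSet_eq_torsionSubmodule
      (h.commutesWithProducts_of_isDefinable he.1) (h.commutesWithDirectLimits_of_isDefinable he.2)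
    obtain ⟨τ, hτ, hτ'⟩ := exists_isPosPrimitive_of_ppSet r s
    have hd : DefinesRadical τ T := fun M x => (hrs M x).trans (hτ' M x).symm
    have hT := h.eq_modelClass_allSentence hd
    have hF := h.eq_modelClass_onlyZeroSentence hd
    exact ⟨τ, hτ, hd, hT, hF, ⟨_, hT⟩, ⟨_, hF⟩⟩
  · rintro ⟨τ, hτ, hd, -⟩
    obtain ⟨m, k, r, s, h'⟩ := exists_ppSet_of_isPosPrimitive hτ
    exact elementary_of_ppSet fun M x => (hd M x).trans (h' M x)
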